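/- Let $\mathcal H$ be a separable infinite-dimensional complex Hilbert space and let $p,q\in\mathcal B(\mathcal H)$ be (orthogonal) projections. Write $p^\perp=1-p$, $q^\perp=1-q$, and let $p\wedge q$ denote the projection onto $p\mathcal H\cap q\mathcal H$. For an ideal $\mathcal J$ let $\mathcal J^2$ be the ideal generated by all products $ab$ with $a,b\in\mathcal J$, and let $\mathcal L^1$, $\mathcal L^2$ be the trace-class and the Hilbert--Schmidt operators. (a) Let $\mathcal J$ be a two-sided ideal of $\mathcal B(\mathcal H)$ with $\{0\}\ne\mathcal J\ne\mathcal B(\mathcal H)$. Then the following are equivalent: (i) $p-q\in\mathcal J$; (ii) $q(p-q)q\in\mathcal J^2$ and $q^\perp(p-q)q^\perp\in\mathcal J^2$; (iii) the projections $p\wedge q^\perp$ and $p^\perp\wedge q$ have finite rank, and at least one of the conditions $q(p-q)q\in\mathcal J^2$ and $q^\perp(p-q)q^\perp\in\mathcal J^2$ holds. (b) If $p-q\in\mathcal L^2$, then the operator $q|_{p\mathcal H}:p\mathcal H\to q\mathcal H$ is Fredholm, the operator $q(p-q)q+q^\perp(p-q)q^\perp$ belongs to $\mathcal L^1$, and $$[p:q]=\operatorname{tr}\bigl(q(p-q)q+q^\perp(p-q)q^\perp\bigr),$$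 where $[p:q]$ is the essential codimension of the pair, i.e. the Fredholm index $\dim\ker-\dim\operatorname{coker}$ of $q|_{p\mathcal H}:p\mathcal H\to q\mathcal H$. -/

import Mathlib

noncomputable section

namespace ProjPair

open scoped InnerProductSpace

variable {H : Type*} [NormedAddCommGroup H] [InnerProductSpace ℂ H]

/-- An operator of finite rank. A projection in `B(H)` is called finite when it has finite rank,
equivalently when its trace is finite. -/
def IsFiniteRank (e : H →L[ℂ] H) : Prop :=
  FiniteDimensional ℂ e.range

/-- The meet `p ∧ q` of two projections: the orthogonal projection onto the intersection of their
ranges. The ranges of projections are closed, and so is their intersection; the closure is taken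
only so that the formula makes sense for all operators. -/
def projMeet [CompleteSpace H] (p q : H →L[ℂ] H) : H →L[ℂ] H :=
  (p.range ⊓ q.range).topologicalClosure.starProjection

/-- For projections, the closure in `projMeet` has no effect. -/
theorem topologicalClosure_range_inf_range {p q : H →L[ℂ] H}
    (hp : IsIdempotentElem p) (hq : IsIdempotentElem q) :
    (p.range ⊓ q.range).topologicalClosure = p.range ⊓ q.range := by
  apply IsClosed.submodule_topologicalClosure_eq
  exact (ContinuousLinearMap.IsIdempotentElem.isClosed_range hp).inter
    (ContinuousLinearMap.IsIdempotentElem.isClosed_range hq)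

/-- A Hilbert–Schmidt operator (an element of `L²`): `∑ ‖T e‖² < ∞` for every orthonormal basis.
The index type ranges over the subsets of `H` since every orthonormal basis is indexed, up to
a bijection, by its own range. -/
def IsHilbertSchmidt (T : H →L[ℂ] H) : Prop :=
  ∀ (s : Set H) (b : HilbertBasis s ℂ H), Summable fun i => ‖T (b i)‖ ^ 2

/-- A trace-class operator (an element of `L¹`): `∑ ⟨e, |T| e⟩ < ∞` for every orthonormal basis,
where `|T| = (T* T)^{1/2}`. -/
def IsTraceClass [CompleteSpace H] (T : H →L[ℂ] H) : Prop :=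
  ∀ (s : Set H) (b : HilbertBasis s ℂ H), Summable fun i => ⟪b i, CFC.abs T (b i)⟫_ℂ

/-- `T` is trace class and its trace is `c`, that is, `∑ ⟨e, T e⟩ = c` for every orthonormal
basis. -/
def HasTrace [CompleteSpace H] (T : H →L[ℂ] H) (c : ℂ) : Prop :=
  IsTraceClass T ∧
    ∀ (s : Set H) (b : HilbertBasis s ℂ H), HasSum (fun i => ⟪b i, T (b i)⟫_ℂ) c

section Fredholm

variable {E F : Type*} [NormedAddCommGroup E] [InnerProductSpace ℂ E]
  [NormedAddCommGroup F] [InnerProductSpace ℂ F]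

/-- The index `dim ker T - dim coker T` of a Fredholm operator. -/
def fredholmIndex (T : E →L[ℂ] F) : ℤ :=
  (Module.finrank ℂ T.ker : ℤ) - (Module.finrank ℂ (F ⧸ T.range) : ℤ)

end Fredholm

/-- The operator `q|_{pH}`, from the range of `p` to the range of `q`. -/
def restrictRange (p q : H →L[ℂ] H) : p.range →L[ℂ] q.range :=
  q.rangeRestrict.comp p.range.subtypeL

/-- `(p, q)` is a Fredholm pair: `q|_{pH} : pH → qH` is a Fredholm operator. -/
def IsFredholmPair (p q : H →L[ℂ] H) : Prop :=
  (restrictRange p q).IsFredholm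

/-- The essential codimension `[p : q]` of a Fredholm pair: the index of `q|_{pH} : pH → qH`. -/
def essCodim (p q : H →L[ℂ] H) : ℤ :=
  fredholmIndex (restrictRange p q)

end ProjPair

end

/-! Put `x = p - q` and `s = 1 - p - q`.

(a) The corners are, up to sign, squares: `q x q = -A* A` with `A = (1 - p) q`, and `(1 - q) x (1 -
q) = B* B` with `B = p (1 - q)`, while `x = B - A`. Since `A* A ∈ J²` forces `A ∈ J`
(`mem_of_star_mul_self_mem_sq`), (i) and (ii) agree. Elements of a proper ideal are tail-small, that
is, compact (`isTailSmall_of_mem`), and `x` is isometric on both meets, so (i) gives (iii).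
Conversely, if `A ∈ J` and `p ∧ (1 - q)` is finite, then `q p` has a left inverse `W` modulo finite
rank (`exists_quasiInverse`), so `B` agrees modulo finite rank with `W q p (1 - q) = -W q (1 - p) (1
- q) ∈ J`. The other corner follows by passing to complements.

(b) The same `W` gives the Fredholm property. The diagonal part of `x` is `(1 - q) x² (1 - q) - q x²
q`. With `y = |x|` and Hilbert–Schmidt norms, let `d k = ‖y^k (1 - q)‖² - ‖y^k q‖²`, so that `d 1`
is the trace. As `x² + s² = 1`, `d k - d (k+1)` compares the two corners of `s y^k`, which have
equal norm, so `d` is constant. As `k → ∞`, `y^k` dies off `ker s`, and `d k` tends to `dim (p ∧ (1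
- q)) - dim (q ∧ (1 - p))`, which is the index. -/

namespace ProjPair

open scoped InnerProductSpace

/-! ### Factorization of dominated operators. -/

section Douglas

variable {E F G : Type*} [NormedAddCommGroup E] [NormedSpace ℂ E]
  [NormedAddCommGroup F] [NormedSpace ℂ F] [CompleteSpace F]
  [NormedAddCommGroup G] [InnerProductSpace ℂ G] [CompleteSpace G]

/-- Douglas' factorization lemma: an operator dominated by `B` factors through `B`. -/
theorem exists_comp_eq_of_norm_le (A : E →L[ℂ] F) (B : E →L[ℂ] G) (c : ℝ)
    (h : ∀ v, ‖A v‖ ≤ c * ‖B v‖) : ∃ C : G →L[ℂ] F, C.comp B = A := by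
  let K := B.range.topologicalClosure
  have hBK : ∀ v, B v ∈ K := fun v => B.range.le_topologicalClosure ⟨v, rfl⟩
  let e : E →ₗ[ℂ] K := B.toLinearMap.codRestrict K hBK
  have he : DenseRange e := by
    rw [DenseRange, Subtype.dense_iff]
    intro x hx
    have hx' : x ∈ closure (Set.range B) := hx
    convert hx' using 2
    ext y
    constructor
    · rintro ⟨_, ⟨v, rfl⟩, rfl⟩
      exact ⟨v, rfl⟩
    · rintro ⟨v, rfl⟩
      exact ⟨e v, ⟨v, rfl⟩, rfl⟩
  have hle : ∃ C, ∀ x, ‖A.toLinearMap x‖ ≤ C * ‖e x‖ := ⟨c, h⟩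
  refine ⟨(A.toLinearMap.extendOfNorm e).comp K.orthogonalProjectionOnto, ?_⟩
  ext v
  have h1 : K.orthogonalProjectionOnto (B v) = e v :=
    K.orthogonalProjectionOnto_mem_subspace_eq_self (e v)
  simp only [ContinuousLinearMap.comp_apply, h1]
  exact LinearMap.extendOfNorm_eq he hle v

end Douglas

/-! ### Orthonormal systems, tail-small operators, finite-rank operators in ideals. -/

theorem ideal_sq {R : Type*} [Ring R] (J : Ideal R) : J ^ 2 = J * J := by
  rw [Submodule.pow_succ, Submodule.pow_one]

variable {H : Type*} [NormedAddCommGroup H] [InnerProductSpace ℂ H]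

/-- Parseval's identity. -/
theorem hasSum_norm_inner_sq {ι : Type*} (b : HilbertBasis ι ℂ H) (v : H) :
    HasSum (fun i => ‖⟪b i, v⟫_ℂ‖ ^ 2) (‖v‖ ^ 2) := by
  have h := b.hasSum_inner_mul_inner v v
  rw [inner_self_eq_norm_sq_to_K] at h
  have h2 := Complex.hasSum_re h
  convert h2 using 1
  · ext i
    rw [← inner_conj_symm v, Complex.conj_mul']
    norm_cast
  · norm_cast

/-- Distinct orthonormal vectors are at distance `√2`, so balls of radius `1/2` around them are
disjoint. -/
theorem orthonormal_countable [TopologicalSpace.SeparableSpace H] {ι : Type*} {b : ι → H}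
    (hb : Orthonormal ℂ b) : Countable ι := by
  have hd : Pairwise fun i j => Disjoint (Metric.ball (b i) (1 / 2)) (Metric.ball (b j) (1 / 2)) := by
    intro i j hij
    apply Metric.ball_disjoint_ball
    have h : ‖b i - b j‖ ^ 2 = 2 := by
      rw [@norm_sub_sq ℂ, hb.1, hb.1, hb.2 hij]
      norm_num
    rw [dist_eq_norm]
    nlinarith [norm_nonneg (b i - b j)]
  have := Set.PairwiseDisjoint.countable_of_isOpen (a := Set.univ)
    (s := fun i => Metric.ball (b i) (1 / 2)) (fun i _ j _ hij => hd hij)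
    (fun i _ => Metric.isOpen_ball) (fun i _ => ⟨b i, by simp⟩)
  exact Set.countable_univ_iff.mp this

/-- An operator which is arbitrarily small on suitable subspaces of finite codimension. -/
def IsTailSmall (T : H →L[ℂ] H) : Prop :=
  ∀ ε > 0, ∃ F : Submodule ℂ H, FiniteDimensional ℂ F ∧ ∀ v ∈ Fᗮ, ‖T v‖ ≤ ε * ‖v‖

theorem IsTailSmall.of_norm_le {S T : H →L[ℂ] H} (hT : IsTailSmall T)
    (h : ∀ v, ‖S v‖ ≤ ‖T v‖) : IsTailSmall S := fun ε hε =>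
  let ⟨F, hF, hF'⟩ := hT ε hε
  ⟨F, hF, fun v hv => (h v).trans (hF' v hv)⟩

/-- A subspace on which a tail-small operator is isometric has finite dimension. -/
theorem IsTailSmall.finiteDimensional {T : H →L[ℂ] H} (hT : IsTailSmall T) {N : Submodule ℂ H}
    (hN : ∀ v ∈ N, ‖v‖ ≤ ‖T v‖) : FiniteDimensional ℂ N := by
  obtain ⟨F, hF, hF'⟩ := hT (1 / 2) (by norm_num)
  -- Injective: `v ∈ N` orthogonal to `F` would satisfy `‖v‖ ≤ ‖v‖ / 2`.
  let f : N →ₗ[ℂ] F := F.orthogonalProjectionOnto.toLinearMap ∘ₗ N.subtype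
  have hf : Function.Injective f := by
    rw [injective_iff_map_eq_zero]
    intro v hv
    have hv' : (v : H) ∈ Fᗮ := Submodule.orthogonalProjectionOnto_eq_zero_iff.mp hv
    have h1 := hN v v.2
    have h2 := hF' v hv'
    have h3 : ‖(v : H)‖ = 0 := by linarith [norm_nonneg (v : H)]
    simpa using h3
  exact Module.Finite.of_injective f hf

/-- Sandwich a `T ∈ J` with `T v ≠ 0` between two rank-one operators, one producing `v` and one
detecting `T v`. -/
theorem rankOne_mem {J : Ideal (H →L[ℂ] H)} [J.IsTwoSided] (hJ : J ≠ ⊥) (a b : H) : InnerProductSpace.rankOne ℂ a b ∈ J := by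
  obtain ⟨T, hT, hT0⟩ := J.ne_bot_iff.mp hJ
  obtain ⟨v, hv⟩ : ∃ v, T v ≠ 0 := by
    by_contra hn
    push Not at hn
    exact hT0 (ContinuousLinearMap.ext hn)
  have h : InnerProductSpace.rankOne ℂ a b = InnerProductSpace.rankOne ℂ a
      (((⟪T v, T v⟫_ℂ)⁻¹) • T v) * (T * InnerProductSpace.rankOne ℂ v b) := by
    have h0 : ⟪T v, T v⟫_ℂ ≠ 0 := inner_self_ne_zero.mpr hv
    ext x
    simp only [mul_apply_eq_comp, InnerProductSpace.rankOne_apply, map_smul,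
      inner_smul_left, map_inv₀, inner_conj_symm]
    rw [smul_smul]
    congr 1
    field_simp
  rw [h]
  exact J.mul_mem_left _ (J.mul_mem_right _ hT)

theorem mem_of_isFiniteRank {J : Ideal (H →L[ℂ] H)} [J.IsTwoSided] (hJ : J ≠ ⊥) {T : H →L[ℂ] H} (hT : IsFiniteRank T) : T ∈ J := by
  have : FiniteDimensional ℂ T.range := hT
  have h : T = T.range.starProjection * T := by
    ext v
    exact (Submodule.starProjection_eq_self_iff.mpr (LinearMap.mem_range_self T.toLinearMap v)).symm
  rw [h, (stdOrthonormalBasis ℂ T.range).starProjection_eq_sum_rankOne]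
  exact J.mul_mem_right _ (J.sum_mem fun i _ => rankOne_mem hJ _ _)

variable [CompleteSpace H]

/-- An operator which is not tail-small is bounded below by some `ε` on an orthonormal sequence
with orthogonal images. -/
theorem exists_orthonormal_seq_of_not_isTailSmall {T : H →L[ℂ] H} (hT : ¬ IsTailSmall T) :
    ∃ ε > 0, ∃ v : ℕ → H, Orthonormal ℂ v ∧ (∀ n, ε ≤ ‖T (v n)‖) ∧
      ∀ m n, m ≠ n → ⟪T (v m), T (v n)⟫_ℂ = 0 := by
  rw [IsTailSmall] at hT
  push Not at hT
  obtain ⟨ε, hε, h⟩ := hT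
  obtain ⟨v, hv, hr⟩ := exists_seq_of_forall_finset_exists (fun v : H => ‖v‖ = 1 ∧ ε ≤ ‖T v‖)
    (fun x y => ⟪x, y⟫_ℂ = 0 ∧ ⟪T x, T y⟫_ℂ = 0) (by
      intro s _
      -- Orthogonality to `T* T x` makes the images `T x` and `T v` orthogonal.
      let F : Submodule ℂ H := Submodule.span ℂ
        ((s : Set H) ∪ (fun x => T.adjoint (T x)) '' (s : Set H))
      have hF : FiniteDimensional ℂ F := by
        apply FiniteDimensional.span_of_finite
        exact s.finite_toSet.union (s.finite_toSet.image _)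
      obtain ⟨v, hvF, hv⟩ := h F hF
      have hv0 : 0 < ‖v‖ := by
        rcases (norm_nonneg v).eq_or_lt with h0 | h0
        · rw [← h0, mul_zero] at hv
          have : v = 0 := norm_eq_zero.mp h0.symm
          simp [this] at hv
        · exact h0
      refine ⟨((‖v‖⁻¹ : ℝ) : ℂ) • v, ⟨?_, ?_⟩, fun x hx => ⟨?_, ?_⟩⟩
      · rw [norm_smul]
        simp [hv0.ne']
      · rw [map_smul, norm_smul]
        simp only [Complex.norm_real, norm_inv, norm_norm]
        rw [← div_eq_inv_mul, le_div_iff₀ hv0]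
        exact hv.le
      · rw [inner_smul_right, hvF x (Submodule.subset_span (Or.inl hx)), mul_zero]
      · rw [map_smul, inner_smul_right, ← ContinuousLinearMap.adjoint_inner_left,
          hvF _ (Submodule.subset_span (Or.inr ⟨x, hx, rfl⟩)), mul_zero])
  refine ⟨ε, hε, v, ⟨fun n => (hv n).1, fun m n hmn => ?_⟩, fun n => (hv n).2, fun m n hmn => ?_⟩
  · rcases lt_or_gt_of_ne hmn with h | h
    · exact (hr m n h).1
    · exact inner_eq_zero_symm.mp (hr n m h).1
  · rcases lt_or_gt_of_ne hmn with h | h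
    · exact (hr m n h).2
    · exact inner_eq_zero_symm.mp (hr n m h).2

/-- On a separable space, an operator which is not tail-small is bounded below on the range of
some isometry. -/
theorem exists_isometry_of_not_isTailSmall [TopologicalSpace.SeparableSpace H] {T : H →L[ℂ] H}
    (hT : ¬ IsTailSmall T) :
    ∃ V : H →L[ℂ] H, ∃ c : ℝ, ∀ h, ‖h‖ ≤ c * ‖T (V h)‖ := by
  obtain ⟨ε, hε, v, hv, hTv, hTo⟩ := exists_orthonormal_seq_of_not_isTailSmall hT
  obtain ⟨w, b, -⟩ := exists_hilbertBasis ℂ H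
  have hw : Countable w := orthonormal_countable b.orthonormal
  obtain ⟨g, hg⟩ := exists_injective_nat w
  have hvg : Orthonormal ℂ (v ∘ g) := hv.comp g hg
  let V₀ := hvg.orthogonalFamily.linearIsometry
  refine ⟨V₀.toContinuousLinearMap.comp b.repr.toContinuousLinearEquiv.toContinuousLinearMap,
    ε⁻¹, fun h => ?_⟩
  set y := T (V₀ (b.repr h))
  change ‖h‖ ≤ ε⁻¹ * ‖y‖
  have hpos : ∀ n, 0 < ‖T (v n)‖ := fun n => hε.trans_le (hTv n)
  have hsum : HasSum (fun i : w => b.repr h i • T (v (g i))) y := by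
    have h1 := hvg.orthogonalFamily.hasSum_linearIsometry (b.repr h)
    have h2 := T.hasSum h1
    convert h2 using 1
    ext i
    exact (map_smul T _ _).symm
  have hinner : ∀ i, ⟪T (v (g i)), y⟫_ℂ = b.repr h i * ((‖T (v (g i))‖ ^ 2 : ℝ) : ℂ) := by
    intro i
    have h1 := (innerSL ℂ (T (v (g i)))).hasSum hsum
    refine h1.unique ?_
    have h2 : innerSL ℂ (T (v (g i))) (b.repr h i • T (v (g i)))
        = b.repr h i * ((‖T (v (g i))‖ ^ 2 : ℝ) : ℂ) := by
      rw [innerSL_apply_apply, inner_smul_right, inner_self_eq_norm_sq_to_K]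
      norm_cast
    rw [← h2]
    refine hasSum_single (f := fun j => innerSL ℂ (T (v (g i))) (b.repr h j • T (v (g j)))) i ?_
    intro j hj
    rw [innerSL_apply_apply, inner_smul_right, hTo _ _ (fun hh => hj (hg hh).symm), mul_zero]
  -- Bessel for the normalized images `u`, against Parseval for `b`, bounds `‖y‖` below by `ε ‖h‖`.
  let u : w → H := fun i => ((‖T (v (g i))‖⁻¹ : ℝ) : ℂ) • T (v (g i))
  have hu : Orthonormal ℂ u := by
    refine ⟨fun i => ?_, fun i j hij => ?_⟩
    · simp only [u, norm_smul, Complex.norm_real, norm_inv, norm_norm]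
      exact inv_mul_cancel₀ (hpos _).ne'
    · simp only [u, inner_smul_left, inner_smul_right]
      rw [hTo _ _ (fun hh => hij (hg hh)), mul_zero, mul_zero]
  have hui : ∀ i, ε ^ 2 * ‖⟪b i, h⟫_ℂ‖ ^ 2 ≤ ‖⟪u i, y⟫_ℂ‖ ^ 2 := by
    intro i
    have : ‖⟪u i, y⟫_ℂ‖ = ‖⟪b i, h⟫_ℂ‖ * ‖T (v (g i))‖ := by
      simp only [u, inner_smul_left, hinner, b.repr_apply_apply, norm_mul, Complex.conj_ofReal,
        Complex.norm_real, norm_inv, norm_norm, norm_pow]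
      field_simp [(hpos (g i)).ne']
    rw [this, mul_pow, mul_comm]
    gcongr
    exact hTv _
  have hP := hasSum_norm_inner_sq b h
  have h1 : ε ^ 2 * ‖h‖ ^ 2 ≤ ‖y‖ ^ 2 := by
    rw [← (hP.mul_left (ε ^ 2)).tsum_eq]
    refine le_trans ?_ (hu.tsum_inner_products_le y)
    exact (hP.mul_left (ε ^ 2)).summable.tsum_le_tsum hui (hu.inner_products_summable y)
  rw [← div_eq_inv_mul, le_div_iff₀ hε]
  rw [← mul_pow] at h1
  have := abs_le_of_sq_le_sq' h1 (norm_nonneg y)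
  linarith [this.2, mul_comm ε ‖h‖]

/-! ### Ideals of `B(H)`: compactness, adjoints, square roots. -/

section Ideal

variable {J : Ideal (H →L[ℂ] H)}

/-- Otherwise `T V` is bounded below for some `V`, hence left invertible by Douglas, and `1 ∈ J`. -/
theorem isTailSmall_of_mem [J.IsTwoSided] [TopologicalSpace.SeparableSpace H] (hJ : J ≠ ⊤) {T : H →L[ℂ] H}
    (hT : T ∈ J) : IsTailSmall T := by
  by_contra hn
  obtain ⟨V, c, hV⟩ := exists_isometry_of_not_isTailSmall hn
  obtain ⟨C, hC⟩ := exists_comp_eq_of_norm_le (1 : H →L[ℂ] H) (T.comp V) c hV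
  apply hJ
  rw [Ideal.eq_top_iff_one, ← hC]
  exact J.mul_mem_left C (J.mul_mem_right V hT)

theorem mem_of_norm_le {S T : H →L[ℂ] H} (hT : T ∈ J) (c : ℝ) (h : ∀ v, ‖S v‖ ≤ c * ‖T v‖) :
    S ∈ J := by
  obtain ⟨C, hC⟩ := exists_comp_eq_of_norm_le S T c h
  rw [← hC]
  exact J.mul_mem_left C hT

theorem norm_abs_apply (T : H →L[ℂ] H) (v : H) : ‖CFC.abs T v‖ = ‖T v‖ := by
  have h1 : IsSelfAdjoint (CFC.abs T) := IsSelfAdjoint.of_nonneg (CFC.abs_nonneg T)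
  have h2 := CFC.abs_mul_abs T
  have key : ∀ A : H →L[ℂ] H, ‖A v‖ ^ 2 = RCLike.re ⟪(star A * A) v, v⟫_ℂ := by
    intro A
    rw [mul_apply_eq_comp, ContinuousLinearMap.star_eq_adjoint,
      ContinuousLinearMap.adjoint_inner_left, inner_self_eq_norm_sq]
  have h3 : ‖CFC.abs T v‖ ^ 2 = ‖T v‖ ^ 2 := by
    rw [key, key, h1.star_eq, h2]
  exact (sq_eq_sq₀ (norm_nonneg _) (norm_nonneg _)).mp h3

/-- Two-sided ideals of `B(H)` are self-adjoint. -/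
theorem star_mem [J.IsTwoSided] {T : H →L[ℂ] H} (hT : T ∈ J) : star T ∈ J := by
  have h1 : CFC.abs T ∈ J := mem_of_norm_le hT 1 fun v => by rw [norm_abs_apply, one_mul]
  obtain ⟨C, hC⟩ := exists_comp_eq_of_norm_le T (CFC.abs T) 1
    fun v => by rw [norm_abs_apply, one_mul]
  have h2 : star T = CFC.abs T * star C := by
    have : T = C * CFC.abs T := hC.symm
    rw [this, star_mul, (IsSelfAdjoint.of_nonneg (CFC.abs_nonneg T)).star_eq, ← this]
  rw [h2]
  exact J.mul_mem_right _ h1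

/-- `W = (S* S + T* T)^{1/2}` factors through the column `(S, T) : H → H ⊕ H`, so `W = C₁ S + C₂ T`.
-/
theorem exists_mem_norm_sq_eq_add {S T : H →L[ℂ] H} (hS : S ∈ J) (hT : T ∈ J) :
    ∃ W ∈ J, ∀ v, ‖W v‖ ^ 2 = ‖S v‖ ^ 2 + ‖T v‖ ^ 2 := by
  let Z : H →L[ℂ] WithLp 2 (H × H) :=
    (WithLp.prodContinuousLinearEquiv 2 ℂ H H).symm.toContinuousLinearMap.comp (S.prod T)
  have hZ : ∀ v, ‖Z v‖ ^ 2 = ‖S v‖ ^ 2 + ‖T v‖ ^ 2 := fun v =>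
    WithLp.prod_norm_sq_eq_of_L2 _
  let A := star S * S + star T * T
  have hA : 0 ≤ A := add_nonneg (star_mul_self_nonneg S) (star_mul_self_nonneg T)
  let W := CFC.sqrt A
  have hW : ∀ v, ‖W v‖ ^ 2 = ‖S v‖ ^ 2 + ‖T v‖ ^ 2 := by
    intro v
    have key : ∀ B : H →L[ℂ] H, ‖B v‖ ^ 2 = RCLike.re ⟪(star B * B) v, v⟫_ℂ := by
      intro A
      rw [mul_apply_eq_comp, ContinuousLinearMap.star_eq_adjoint,
        ContinuousLinearMap.adjoint_inner_left, inner_self_eq_norm_sq]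
    rw [key, key, key, (IsSelfAdjoint.of_nonneg (CFC.sqrt_nonneg A)).star_eq,
      CFC.sqrt_mul_sqrt_self A hA, ← map_add, ← inner_add_left]
    rfl
  refine ⟨W, ?_, hW⟩
  obtain ⟨C, hC⟩ := exists_comp_eq_of_norm_le W Z 1 fun v => by
    rw [one_mul]
    exact (sq_le_sq₀ (norm_nonneg _) (norm_nonneg _)).mp (by rw [hW, hZ])
  let e := (WithLp.prodContinuousLinearEquiv 2 ℂ H H).symm.toContinuousLinearMap
  have h : W = (C.comp (e.comp (ContinuousLinearMap.inl ℂ H H))) * S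
      + (C.comp (e.comp (ContinuousLinearMap.inr ℂ H H))) * T := by
    rw [← hC]
    ext v
    simp only [add_apply, mul_apply_eq_comp,
      ContinuousLinearMap.comp_apply, ← map_add]
    congr 1
    change Z v = e (S v, 0) + e (0, T v)
    rw [← map_add, Prod.mk_add_mk, add_zero, zero_add]
    rfl
  rw [h]
  exact J.add_mem (J.mul_mem_left _ hS) (J.mul_mem_left _ hT)

/-- For a product, `|⟨x y v, v⟩| ≤ ‖y v‖ ‖x* v‖`; the previous lemma absorbs both the two factors
and sums of products into a single `W`. -/
theorem exists_mem_norm_inner_le [J.IsTwoSided] {T : H →L[ℂ] H} (hT : T ∈ J ^ 2) :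
    ∃ W ∈ J, ∀ v, ‖⟪T v, v⟫_ℂ‖ ≤ ‖W v‖ ^ 2 := by
  rw [ideal_sq] at hT
  refine Submodule.mul_induction_on hT ?_ ?_
  · intro x hx y hy
    obtain ⟨W, hW, h⟩ := exists_mem_norm_sq_eq_add hy (star_mem hx)
    refine ⟨W, hW, fun v => ?_⟩
    rw [h, mul_apply_eq_comp, ← ContinuousLinearMap.adjoint_inner_right,
      ← ContinuousLinearMap.star_eq_adjoint]
    refine (norm_inner_le_norm _ _).trans ?_
    nlinarith [sq_nonneg (‖y v‖ - ‖star x v‖), sq_nonneg (‖y v‖), sq_nonneg ‖star x v‖]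
  · rintro S T ⟨W, hW, h⟩ ⟨W', hW', h'⟩
    obtain ⟨W'', hW'', h''⟩ := exists_mem_norm_sq_eq_add hW hW'
    refine ⟨W'', hW'', fun v => ?_⟩
    rw [h'', add_apply, inner_add_left]
    exact (norm_add_le _ _).trans (add_le_add (h v) (h' v))

/-- If `A* A` belongs to `J²`, then `A` belongs to `J`. -/
theorem mem_of_star_mul_self_mem_sq [J.IsTwoSided] {A : H →L[ℂ] H} (h : star A * A ∈ J ^ 2) : A ∈ J := by
  obtain ⟨W, hW, hle⟩ := exists_mem_norm_inner_le h
  refine mem_of_norm_le hW 1 fun v => ?_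
  rw [one_mul]
  refine (sq_le_sq₀ (norm_nonneg _) (norm_nonneg _)).mp (le_trans ?_ (hle v))
  rw [mul_apply_eq_comp, ContinuousLinearMap.star_eq_adjoint,
    ContinuousLinearMap.adjoint_inner_left, inner_self_eq_norm_sq_to_K]
  simp

end Ideal

end ProjPair

/-! ### Part (a): inversion modulo finite rank and the equivalences. -/

namespace ProjPair

open scoped InnerProductSpace

variable {H : Type*} [NormedAddCommGroup H] [InnerProductSpace ℂ H]

theorem isFiniteRank_iff {T : H →L[ℂ] H} : IsFiniteRank T ↔ T.toLinearMap.HasFiniteRange :=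
  Module.Finite.iff_fg

theorem IsFiniteRank.mul_left {T : H →L[ℂ] H} (hT : IsFiniteRank T) (S : H →L[ℂ] H) :
    IsFiniteRank (S * T) :=
  isFiniteRank_iff.mpr ((isFiniteRank_iff.mp hT).comp_left S.toLinearMap)

theorem IsFiniteRank.mul_right {T : H →L[ℂ] H} (hT : IsFiniteRank T) (S : H →L[ℂ] H) :
    IsFiniteRank (T * S) :=
  isFiniteRank_iff.mpr ((isFiniteRank_iff.mp hT).comp_right S.toLinearMap)

theorem IsFiniteRank.neg {T : H →L[ℂ] H} (hT : IsFiniteRank T) : IsFiniteRank (-T) :=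
  isFiniteRank_iff.mpr (isFiniteRank_iff.mp hT).neg

theorem mem_range_iff_of_isIdempotentElem {p : H →L[ℂ] H} (hp : IsIdempotentElem p) {v : H} :
    v ∈ p.range ↔ p v = v := by
  constructor
  · rintro ⟨w, rfl⟩
    exact congr($(hp.eq) w)
  · exact fun h => ⟨v, h⟩

/-- Rank–nullity for `q` restricted to the range of `g`. -/
theorem isFiniteRank_of_mul {q g : H →L[ℂ] H} (h : IsFiniteRank (q * g))
    (hk : FiniteDimensional ℂ (g.range ⊓ q.ker : Submodule ℂ H)) : IsFiniteRank g := by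
  let T : g.range →ₗ[ℂ] H := q.toLinearMap ∘ₗ g.range.subtype
  have h1 : FiniteDimensional ℂ (LinearMap.ker T) := by
    let i : LinearMap.ker T →ₗ[ℂ] (g.range ⊓ q.ker : Submodule ℂ H) :=
      (g.range.subtype ∘ₗ (LinearMap.ker T).subtype).codRestrict _ fun v => ⟨v.1.2, v.2⟩
    refine Module.Finite.of_injective i fun v w hvw => ?_
    have := congrArg Subtype.val hvw
    exact Subtype.ext (Subtype.ext this)
  have h2 : FiniteDimensional ℂ (LinearMap.range T) := by
    have h' : FiniteDimensional ℂ (q * g).range := h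
    have : LinearMap.range T ≤ (q * g).range := by
      rintro _ ⟨⟨_, v, rfl⟩, rfl⟩
      exact ⟨v, rfl⟩
    exact Submodule.finiteDimensional_of_le this
  have h3 : FiniteDimensional ℂ (g.range ⧸ LinearMap.ker T) :=
    Module.Finite.equiv T.quotKerEquivRange.symm
  exact Module.Finite.of_submodule_quotient (LinearMap.ker T)

theorem corner_mem_sq_of_sub_mem {J : Ideal (H →L[ℂ] H)} [J.IsTwoSided] {p q : H →L[ℂ] H}
    (hp : IsIdempotentElem p) (hq : IsIdempotentElem q)
    (h : p - q ∈ J) : q * (p - q) * q ∈ J ^ 2 := by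
  have e : q * (p - q) * q = (q * (p - q)) * ((p - q) * -q) := by
    have hp' : ∀ a, p * (p * a) = p * a := fun a => by rw [← mul_assoc, hp.eq]
    simp only [mul_sub, sub_mul, mul_neg, mul_assoc, hp', hq.eq]
    abel
  rw [e, ideal_sq]
  exact Ideal.mul_mem_mul (J.mul_mem_left _ h) (J.mul_mem_right _ h)

variable [CompleteSpace H]

/-- A tail-small perturbation of the identity is right invertible modulo finite rank. -/
theorem IsTailSmall.exists_mul_eq_one_add {k : H →L[ℂ] H} (hk : IsTailSmall k) :
    ∃ R f : H →L[ℂ] H, IsFiniteRank f ∧ (1 - k) * R = 1 + f := by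
  obtain ⟨F, hF, hF'⟩ := hk (1 / 2) (by norm_num)
  let P := F.starProjection
  -- Split `k` into `k (1 - P)`, small enough for a Neumann series, and the finite-rank `k P`.
  have hn : ‖k * (1 - P)‖ ≤ 1 / 2 := by
    refine ContinuousLinearMap.opNorm_le_bound _ (by norm_num) fun v => ?_
    have h1 : (1 - P) v ∈ Fᗮ := F.sub_starProjection_mem_orthogonal v
    refine (hF' _ h1).trans ?_
    gcongr
    have h2 : (1 - P) v = Fᗮ.starProjection v := by
      rw [F.starProjection_orthogonal]
      rfl
    rw [h2]
    exact Fᗮ.norm_starProjection_apply_le v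
  let u := Units.oneSub (k * (1 - P)) (hn.trans_lt (by norm_num))
  have hu : (u : H →L[ℂ] H) = 1 - k * (1 - P) := rfl
  have hP : IsFiniteRank P := by
    rw [IsFiniteRank, F.range_starProjection]
    exact hF
  refine ⟨(u⁻¹ : (H →L[ℂ] H)ˣ), -(k * P * (u⁻¹ : (H →L[ℂ] H)ˣ)), ((hP.mul_left k).mul_right _).neg,
    ?_⟩
  have h3 : 1 - k = u - k * P := by
    rw [hu, mul_sub, mul_one]
    abel
  rw [h3, sub_mul, Units.mul_inv, sub_eq_add_neg]

/-- If `q (1 - p)` is tail-small and `p ∧ (1 - q)` is finite, then `q p` is invertible, modulo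
finite rank, as an operator from the range of `p` to the range of `q`. -/
theorem exists_quasiInverse {p q : H →L[ℂ] H} (hp : IsIdempotentElem p) (hq : IsIdempotentElem q)
    (hk : IsTailSmall (q * (1 - p)))
    (hN : FiniteDimensional ℂ (p.range ⊓ (1 - q).range : Submodule ℂ H)) :
    ∃ W : H →L[ℂ] H, p * W = W ∧ IsFiniteRank (q * W - q) ∧ IsFiniteRank (W * q * p - p) := by
  obtain ⟨R, f, hf, hR⟩ := hk.exists_mul_eq_one_add
  have hp' : ∀ a, p * (p * a) = p * a := fun a => by rw [← mul_assoc, hp.eq]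
  have hq' : ∀ a, q * (q * a) = q * a := fun a => by rw [← mul_assoc, hq.eq]
  -- Multiply `(1 - k) R = 1 + f` by `q`, using `q (1 - q (1 - p)) = q p`.
  have h1 : q * (p * R) = q + q * f := by
    have := congrArg (q * ·) hR
    simp only [mul_sub, sub_mul, mul_add, mul_one, one_mul, mul_assoc, hq'] at this
    rw [← this]
    abel
  let W := p * R * q
  have h2 : q * W - q = q * f * q := by
    have h : q * W = q * (p * R) * q := by simp only [W, mul_assoc]
    rw [h, h1, add_mul, hq.eq, add_sub_cancel_left]
  have h3 : p * W = W := by simp only [W, mul_assoc, hp']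
  have h4 : IsFiniteRank (q * W - q) := h2 ▸ (hf.mul_left q).mul_right q
  refine ⟨W, h3, h4, isFiniteRank_of_mul (q := q) ?_ ?_⟩
  · have : q * (W * q * p - p) = (q * W - q) * (q * p) := by
      simp only [mul_sub, sub_mul, mul_assoc, hq']
    rw [this]
    exact h4.mul_right _
  -- `W q p - p` has range in `pH`, so what `q` kills there lies in `pH ∩ (1 - q)H`.
  · refine @Submodule.finiteDimensional_of_le _ _ _ _ _ _ _ hN (inf_le_inf ?_ ?_)
    · rintro _ ⟨v, rfl⟩
      refine ⟨(W * q * p - p) v, ?_⟩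
      have : p * (W * q * p - p) = W * q * p - p := by
        rw [mul_sub, hp.eq, ← mul_assoc, ← mul_assoc, h3]
      exact congr($this v)
    · intro v hv
      have hv' : q v = 0 := hv
      exact ⟨v, by simp [hv']⟩

theorem isFiniteRank_projMeet_iff {p q : H →L[ℂ] H} (hp : IsIdempotentElem p)
    (hq : IsIdempotentElem q) :
    IsFiniteRank (projMeet p q) ↔ FiniteDimensional ℂ (p.range ⊓ q.range : Submodule ℂ H) := by
  rw [IsFiniteRank, projMeet, Submodule.range_starProjection,
    topologicalClosure_range_inf_range hp hq]

section Ideal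

variable {J : Ideal (H →L[ℂ] H)} [J.IsTwoSided] {p q : H →L[ℂ] H}

theorem isFiniteRank_projMeet_of_sub_mem [TopologicalSpace.SeparableSpace H] (hJ : J ≠ ⊤)
    (hp : IsStarProjection p) (hq : IsStarProjection q) (h : p - q ∈ J) :
    IsFiniteRank (projMeet p (1 - q)) := by
  rw [isFiniteRank_projMeet_iff hp.isIdempotentElem hq.isIdempotentElem.one_sub]
  refine (isTailSmall_of_mem hJ h).finiteDimensional ?_
  rintro v ⟨h1, h2⟩
  have h1' := (mem_range_iff_of_isIdempotentElem hp.isIdempotentElem).mp h1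
  have h2' := (mem_range_iff_of_isIdempotentElem hq.isIdempotentElem.one_sub).mp h2
  have h3 : q v = 0 := by simpa using h2'
  rw [sub_apply, h1', h3, sub_zero]

theorem one_sub_mul_mem_of_corner_mem_sq (hp : IsStarProjection p) (hq : IsStarProjection q)
    (h : q * (p - q) * q ∈ J ^ 2) : (1 - p) * q ∈ J := by
  apply mem_of_star_mul_self_mem_sq
  have e : star ((1 - p) * q) * ((1 - p) * q) = -(q * (p - q) * q) := by
    have hp' : ∀ a, p * (p * a) = p * a := fun a => by rw [← mul_assoc, hp.isIdempotentElem.eq]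
    rw [star_mul, star_sub, star_one, hp.isSelfAdjoint.star_eq, hq.isSelfAdjoint.star_eq]
    simp only [mul_sub, sub_mul, mul_one, one_mul, mul_assoc, hp',
      hq.isIdempotentElem.eq]
    abel
  rw [e]
  exact neg_mem h

theorem sub_mem_of_corner_mem_sq [TopologicalSpace.SeparableSpace H] (hJ0 : J ≠ ⊥) (hJ : J ≠ ⊤)
    (hp : IsStarProjection p) (hq : IsStarProjection q)
    (hN : IsFiniteRank (projMeet p (1 - q))) (h : q * (p - q) * q ∈ J ^ 2) : p - q ∈ J := by
  have h1 := one_sub_mul_mem_of_corner_mem_sq hp hq h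
  have h2 : q * (1 - p) ∈ J := by
    have := star_mem h1
    rwa [star_mul, star_sub, star_one, hp.isSelfAdjoint.star_eq, hq.isSelfAdjoint.star_eq] at this
  rw [isFiniteRank_projMeet_iff hp.isIdempotentElem
    hq.isIdempotentElem.one_sub] at hN
  obtain ⟨W, -, -, hW⟩ := exists_quasiInverse hp.isIdempotentElem hq.isIdempotentElem
    (isTailSmall_of_mem hJ h2) hN
  have e : p - q = -(W * (q * (1 - p) * (1 - q))) - (W * q * p - p) * (1 - q) - (1 - p) * q := by
    have hq' : ∀ a, q * (q * a) = q * a := fun a => by rw [← mul_assoc, hq.isIdempotentElem.eq]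
    simp only [mul_sub, sub_mul, mul_one, one_mul, mul_assoc, hq.isIdempotentElem.eq]
    abel
  rw [e]
  exact J.sub_mem (J.sub_mem (neg_mem (J.mul_mem_left _ (J.mul_mem_right _ h2)))
    (J.mul_mem_right _ (mem_of_isFiniteRank hJ0 hW))) h1

theorem tfae_sub_mem [TopologicalSpace.SeparableSpace H] (hJ0 : J ≠ ⊥) (hJ : J ≠ ⊤)
    (hp : IsStarProjection p) (hq : IsStarProjection q) :
    List.TFAE [
      p - q ∈ J,
      q * (p - q) * q ∈ J ^ 2 ∧ (1 - q) * (p - q) * (1 - q) ∈ J ^ 2,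
      (IsFiniteRank (projMeet p (1 - q)) ∧ IsFiniteRank (projMeet (1 - p) q)) ∧
        (q * (p - q) * q ∈ J ^ 2 ∨ (1 - q) * (p - q) * (1 - q) ∈ J ^ 2)] := by
  -- Passing to `(1 - p, 1 - q)` exchanges the two corners up to sign, and the two meets.
  have hsub : (1 - p) - (1 - q) = -(p - q) := by abel
  have hcorner : (1 - q) * ((1 - p) - (1 - q)) * (1 - q) = -((1 - q) * (p - q) * (1 - q)) := by
    rw [hsub, mul_neg, neg_mul]
  have h12 : p - q ∈ J →
      q * (p - q) * q ∈ J ^ 2 ∧ (1 - q) * (p - q) * (1 - q) ∈ J ^ 2 := fun h => by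
    refine ⟨corner_mem_sq_of_sub_mem hp.isIdempotentElem hq.isIdempotentElem h, ?_⟩
    have := corner_mem_sq_of_sub_mem (J := J) hp.isIdempotentElem.one_sub
      hq.isIdempotentElem.one_sub (by rw [hsub]; exact neg_mem h)
    rw [hcorner] at this
    exact neg_mem_iff.mp this
  tfae_have 1 → 2 := h12
  tfae_have 2 → 1 := by
    rintro ⟨h1, h2⟩
    have h3 := one_sub_mul_mem_of_corner_mem_sq hp hq h1
    have h4 := one_sub_mul_mem_of_corner_mem_sq (J := J) hp.one_sub hq.one_sub
      (by rw [hcorner]; exact neg_mem h2)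
    have e : p - q = (1 - (1 - p)) * (1 - q) - (1 - p) * q := by
      simp only [mul_sub, sub_mul, mul_one, one_mul]
      abel
    rw [e]
    exact J.sub_mem h4 h3
  tfae_have 1 → 3 := by
    intro h
    refine ⟨⟨isFiniteRank_projMeet_of_sub_mem hJ hp hq h, ?_⟩, Or.inl (h12 h).1⟩
    have := isFiniteRank_projMeet_of_sub_mem (J := J) hJ hp.one_sub hq.one_sub
      (by rw [hsub]; exact neg_mem h)
    rwa [sub_sub_cancel] at this
  tfae_have 3 → 1 := by
    rintro ⟨⟨h1, h2⟩, h | h⟩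
    · exact sub_mem_of_corner_mem_sq hJ0 hJ hp hq h1 h
    · have := sub_mem_of_corner_mem_sq (J := J) hJ0 hJ hp.one_sub hq.one_sub
        (by rwa [sub_sub_cancel]) (by rw [hcorner]; exact neg_mem h)
      rw [hsub] at this
      exact neg_mem_iff.mp this
  tfae_finish

end Ideal

end ProjPair

/-! ### Hilbert–Schmidt sums and limits of powers. -/

namespace ProjPair

open scoped InnerProductSpace
open Filter Topology

variable {H : Type*} [NormedAddCommGroup H] [InnerProductSpace ℂ H]

/-- For a finite-dimensional subspace, the squared Hilbert–Schmidt norm of the projection is the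
dimension. -/
theorem hasSum_norm_starProjection_sq {ι : Type*} (b : HilbertBasis ι ℂ H) (N : Submodule ℂ H)
    [FiniteDimensional ℂ N] :
    HasSum (fun i => ‖N.starProjection (b i)‖ ^ 2) (Module.finrank ℂ N : ℝ) := by
  let f := stdOrthonormalBasis ℂ N
  have h1 : ∀ v, ‖N.starProjection v‖ ^ 2 = ∑ j, ‖⟪v, (f j : H)⟫_ℂ‖ ^ 2 := by
    intro v
    have h2 := f.sum_sq_norm_inner_right (N.orthogonalProjectionOnto v)
    rw [Submodule.starProjection_apply, Submodule.norm_coe, ← h2]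
    refine Finset.sum_congr rfl fun j _ => ?_
    rw [norm_inner_symm, Submodule.inner_orthogonalProjectionOnto_eq_of_mem_right]
  have h3 : HasSum (fun i => ∑ j, ‖⟪b i, (f j : H)⟫_ℂ‖ ^ 2) (∑ j, ‖(f j : H)‖ ^ 2) :=
    hasSum_sum fun j _ => hasSum_norm_inner_sq b (f j : H)
  convert h3 using 1
  · exact funext fun i => h1 (b i)
  · have h4 : ∀ j, ‖(f j : H)‖ = 1 := fun j => f.norm_eq_one j
    simp [h4]

variable [CompleteSpace H]

/-- The Hilbert–Schmidt norm of the adjoint. -/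
theorem hasSum_norm_star_sq {ι : Type*} (b : HilbertBasis ι ℂ H) {A : H →L[ℂ] H} {a : ℝ}
    (h : HasSum (fun i => ‖A (b i)‖ ^ 2) a) : HasSum (fun i => ‖(star A) (b i)‖ ^ 2) a := by
  -- Sum the squared matrix entries by columns and by rows.
  let f : ι × ι → ℝ := fun x => ‖⟪b x.2, A (b x.1)⟫_ℂ‖ ^ 2
  have h1 : ∀ i, HasSum (fun j => f (i, j)) (‖A (b i)‖ ^ 2) := fun i =>
    hasSum_norm_inner_sq b (A (b i))
  have h2 : ∀ j, HasSum (fun i => f (i, j)) (‖(star A) (b j)‖ ^ 2) := fun j => by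
    convert hasSum_norm_inner_sq b ((star A) (b j)) using 2 with i
    rw [ContinuousLinearMap.star_eq_adjoint, ContinuousLinearMap.adjoint_inner_right,
      norm_inner_symm]
  have hf : Summable f := by
    refine (summable_prod_of_nonneg fun x => sq_nonneg _).mpr ⟨fun i => (h1 i).summable, ?_⟩
    exact h.summable.congr fun i => (h1 i).tsum_eq.symm
  have h3 : HasSum f a := by
    rw [← (hf.hasSum.prod_fiberwise h1).unique h]
    exact hf.hasSum
  exact ((Equiv.prodComm ι ι).hasSum_iff.mpr h3).prod_fiberwise h2

/-- The operator norm is dominated by the Hilbert–Schmidt norm. -/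
theorem norm_sq_apply_le {ι : Type*} (b : HilbertBasis ι ℂ H) {A : H →L[ℂ] H} {a : ℝ}
    (h : HasSum (fun i => ‖A (b i)‖ ^ 2) a) (v : H) : ‖A v‖ ^ 2 ≤ a * ‖v‖ ^ 2 := by
  have h1 := hasSum_norm_star_sq b h
  have h2 := hasSum_norm_inner_sq b (A v)
  refine hasSum_le (fun i => ?_) h2 (h1.mul_right (‖v‖ ^ 2))
  rw [← ContinuousLinearMap.adjoint_inner_left, ← ContinuousLinearMap.star_eq_adjoint, ← mul_pow]
  gcongr
  exact norm_inner_le_norm _ _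

/-- Discarding finitely many basis vectors leaves a Hilbert–Schmidt norm below `ε`, which dominates
the operator norm. -/
theorem isTailSmall_of_summable {ι : Type*} (b : HilbertBasis ι ℂ H) {T : H →L[ℂ] H}
    (h : Summable fun i => ‖T (b i)‖ ^ 2) : IsTailSmall T := by
  classical
  intro ε hε
  obtain ⟨a, ha⟩ := h
  have hε2 : 0 < ε ^ 2 := by positivity
  obtain ⟨S, hS⟩ := (ha.eventually (lt_mem_nhds (sub_lt_self a hε2))).exists
  let F : Submodule ℂ H := Submodule.span ℂ (b '' S)
  have hF : FiniteDimensional ℂ F :=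
    FiniteDimensional.span_of_finite ℂ (S.finite_toSet.image b)
  refine ⟨F, hF, fun v hv => ?_⟩
  let A := T * (1 - F.starProjection)
  have hA : ∀ w ∈ Fᗮ, A w = T w := by
    intro w hw
    have : F.starProjection w = 0 := F.starProjection_apply_eq_zero_iff.mpr hw
    simp [A, this]
  have hA' : ∀ i, ‖A (b i)‖ ^ 2 = ‖T (b i)‖ ^ 2 - if i ∈ S then ‖T (b i)‖ ^ 2 else 0 := by
    intro i
    split_ifs with hi
    · have : F.starProjection (b i) = b i :=
        Submodule.starProjection_eq_self_iff.mpr (Submodule.subset_span ⟨i, hi, rfl⟩)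
      simp [A, this]
    · rw [hA, sub_zero]
      have : F ≤ (Submodule.span ℂ {b i})ᗮ := by
        rw [Submodule.span_le]
        rintro _ ⟨j, hj, rfl⟩
        refine Submodule.mem_orthogonal_singleton_iff_inner_right.mpr (b.orthonormal.2 ?_)
        rintro rfl
        exact hi hj
      exact (Submodule.le_orthogonal_iff_le_orthogonal.mp this)
        (Submodule.mem_span_singleton_self _)
  have hsum : HasSum (fun i => ‖A (b i)‖ ^ 2) (a - ∑ i ∈ S, ‖T (b i)‖ ^ 2) := by
    simp_rw [hA']
    refine ha.sub ?_
    have : ∑ i ∈ S, ‖T (b i)‖ ^ 2 = ∑ i ∈ S, if i ∈ S then ‖T (b i)‖ ^ 2 else 0 :=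
      Finset.sum_congr rfl fun i hi => by rw [if_pos hi]
    rw [this]
    exact hasSum_sum_of_ne_finset_zero fun i hi => if_neg hi
  have h1 := norm_sq_apply_le b hsum v
  rw [hA v hv] at h1
  have h2 : ‖T v‖ ^ 2 ≤ (ε * ‖v‖) ^ 2 := by
    rw [mul_pow]
    refine h1.trans ?_
    gcongr
    linarith
  exact (sq_le_sq₀ (norm_nonneg _) (by positivity)).mp h2

theorem norm_sq_apply_eq (A : H →L[ℂ] H) (v : H) :
    ((‖A v‖ ^ 2 : ℝ) : ℂ) = ⟪v, (star A * A) v⟫_ℂ := by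
  rw [mul_apply_eq_comp, ContinuousLinearMap.star_eq_adjoint,
    ContinuousLinearMap.adjoint_inner_right, inner_self_eq_norm_sq_to_K]
  norm_cast

section Powers

variable {y s e : H →L[ℂ] H}

theorem norm_sq_add_norm_sq (hy : IsSelfAdjoint y) (hs : IsSelfAdjoint s)
    (hys : y * y + s * s = 1) (v : H) : ‖y v‖ ^ 2 + ‖s v‖ ^ 2 = ‖v‖ ^ 2 := by
  have h : ((‖y v‖ ^ 2 + ‖s v‖ ^ 2 : ℝ) : ℂ) = ((‖v‖ ^ 2 : ℝ) : ℂ) := by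
    rw [Complex.ofReal_add, norm_sq_apply_eq, norm_sq_apply_eq, hy.star_eq, hs.star_eq,
      ← inner_add_right, ← add_apply, hys, one_apply_eq_self,
      inner_self_eq_norm_sq_to_K]
    norm_cast
  exact_mod_cast h

theorem norm_pow_apply_le (hy : IsSelfAdjoint y) (hs : IsSelfAdjoint s)
    (hys : y * y + s * s = 1) (k : ℕ) (v : H) : ‖(y ^ k) v‖ ≤ ‖v‖ := by
  induction k with
  | zero => simp
  | succ k ih =>
    refine le_trans ?_ ih
    rw [pow_succ', mul_apply_eq_comp]
    have := norm_sq_add_norm_sq hy hs hys ((y ^ k) v)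
    exact (sq_le_sq₀ (norm_nonneg _) (norm_nonneg _)).mp (by nlinarith [sq_nonneg ‖s ((y ^ k) v)‖])

/-- On the range of `s`, `‖y^k s u‖²` is the `k`-th drop of the decreasing sequence `‖y^k u‖²`. That
range is dense in `(ker s)ᗮ`, and the `y^k` are contractions. -/
theorem tendsto_pow_apply_of_mem_orthogonal_ker (hy : IsSelfAdjoint y) (hs : IsSelfAdjoint s)
    (hys : y * y + s * s = 1) (hc : Commute y s) {w : H} (hw : w ∈ s.kerᗮ) :
    Tendsto (fun k => (y ^ k) w) atTop (𝓝 0) := by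
  have hr : ∀ u, Tendsto (fun k => (y ^ k) (s u)) atTop (𝓝 0) := by
    intro u
    have hdiff : ∀ k, ‖(y ^ k) (s u)‖ ^ 2 = ‖(y ^ k) u‖ ^ 2 - ‖(y ^ (k + 1)) u‖ ^ 2 := by
      intro k
      have h1 := norm_sq_add_norm_sq hy hs hys ((y ^ k) u)
      have h2 : (y ^ k) (s u) = s ((y ^ k) u) := congr($((hc.pow_left k).eq) u)
      rw [h2, pow_succ' y, mul_apply_eq_comp]
      linarith
    have hanti : Antitone fun k => ‖(y ^ k) u‖ ^ 2 := antitone_nat_of_succ_le fun k => by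
      nlinarith [hdiff k, sq_nonneg ‖(y ^ k) (s u)‖]
    have hlim := tendsto_atTop_ciInf hanti ⟨0, by rintro _ ⟨k, rfl⟩; positivity⟩
    have h0 : Tendsto (fun k => ‖(y ^ k) (s u)‖ ^ 2) atTop (𝓝 0) := by
      have := hlim.sub (hlim.comp (tendsto_add_atTop_nat 1))
      rw [sub_self] at this
      exact this.congr fun k => (hdiff k).symm
    rw [tendsto_zero_iff_norm_tendsto_zero]
    have := h0.sqrt
    simpa using this
  rw [s.orthogonal_ker, ← ContinuousLinearMap.star_eq_adjoint, hs.star_eq] at hw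
  have hw' : w ∈ closure (Set.range s) := hw
  rw [Metric.tendsto_atTop]
  intro ε hε
  obtain ⟨_, ⟨u, rfl⟩, hu⟩ := Metric.mem_closure_iff.mp hw' (ε / 2) (by positivity)
  obtain ⟨K, hK⟩ := Metric.tendsto_atTop.mp (hr u) (ε / 2) (by positivity)
  refine ⟨K, fun k hk => ?_⟩
  have h1 := hK k hk
  rw [dist_zero_right] at h1 ⊢
  rw [dist_eq_norm] at hu
  have h2 : (y ^ k) w = (y ^ k) (w - s u) + (y ^ k) (s u) := by rw [← map_add, sub_add_cancel]
  rw [h2]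
  refine (norm_add_le _ _).trans_lt ?_
  linarith [norm_pow_apply_le hy hs hys k (w - s u)]

/-- The Hilbert–Schmidt norms of `yᵏ e` converge to that of the projection onto
`ker s ∩ eH = ker (1 - y²) ∩ eH`. -/
theorem tendsto_tsum_norm_pow_sq {ι : Type*} (b : HilbertBasis ι ℂ H)
    (hy : IsSelfAdjoint y) (hs : IsSelfAdjoint s) (hys : y * y + s * s = 1) (hc : Commute y s)
    (he : IsStarProjection e) (hye : Commute y e) (hsum : Summable fun i => ‖y (b i)‖ ^ 2)
    (N : Submodule ℂ H) [FiniteDimensional ℂ N] (hN : ∀ v, v ∈ N ↔ s v = 0 ∧ e v = v) :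
    Tendsto (fun k => ∑' i, ‖(y ^ k) (e (b i))‖ ^ 2) atTop (𝓝 (Module.finrank ℂ N : ℝ)) := by
  let n := N.starProjection
  have hyN : ∀ v ∈ N, ∀ k, ‖(y ^ k) v‖ = ‖v‖ ∧ ((y ^ k) * (y ^ k)) v = v := by
    intro v hv k
    have h1 : (y * y) v = v := by
      have := congr($hys v)
      simpa [((hN v).mp hv).1] using this
    have h2 : ((y ^ k) * (y ^ k)) v = v := by
      rw [← (Commute.refl y).mul_pow]
      induction k with
      | zero => simp
      | succ k ih => rw [pow_succ, mul_apply_eq_comp, h1, ih]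
    refine ⟨?_, h2⟩
    have h3 : ((‖(y ^ k) v‖ ^ 2 : ℝ) : ℂ) = ((‖v‖ ^ 2 : ℝ) : ℂ) := by
      rw [norm_sq_apply_eq, (hy.pow k).star_eq, h2, inner_self_eq_norm_sq_to_K]
      norm_cast
    have h4 : ‖(y ^ k) v‖ ^ 2 = ‖v‖ ^ 2 := by exact_mod_cast h3
    exact (sq_eq_sq₀ (norm_nonneg _) (norm_nonneg _)).mp h4
  have hnN : ∀ v, n v ∈ N := fun v => N.starProjection_apply_mem v
  have hort : ∀ v, e v - n v ∈ Nᗮ := by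
    intro v
    have h1 : e v - n v = (e v - e (n v)) := by rw [((hN _).mp (hnN v)).2]
    rw [h1, ← map_sub]
    intro u hu
    have h2 := (N.sub_starProjection_mem_orthogonal v) u hu
    rw [← ((hN u).mp hu).2, ← he.isSelfAdjoint.star_eq, ContinuousLinearMap.star_eq_adjoint,
      ContinuousLinearMap.adjoint_inner_left, ← ContinuousLinearMap.star_eq_adjoint,
      he.isSelfAdjoint.star_eq, ← mul_apply_eq_comp, he.isIdempotentElem.eq,
      ← ContinuousLinearMap.adjoint_inner_left, ← ContinuousLinearMap.star_eq_adjoint,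
      he.isSelfAdjoint.star_eq, ((hN u).mp hu).2]
    exact h2
  -- `e` commutes with `s² = 1 - y²`, so it maps `ker s` into `N`.
  have hker : ∀ v, e v - n v ∈ s.kerᗮ := by
    intro v u hu
    have hu0 : s u = 0 := hu
    have hee : e (e v - n v) = e v - n v := by
      rw [map_sub, ← mul_apply_eq_comp, he.isIdempotentElem.eq, ((hN _).mp (hnN v)).2]
    have hss : s (e u) = 0 := by
      have hse : s * s * e = e * (s * s) := by
        have : s * s = 1 - y * y := eq_sub_of_add_eq' hys
        rw [this, sub_mul, mul_sub, one_mul, mul_one, (hye.mul_left hye).eq]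
      have h1 : ((‖s (e u)‖ ^ 2 : ℝ) : ℂ) = 0 := by
        rw [norm_sq_apply_eq, hs.star_eq, ← mul_apply_eq_comp (s * s) e, hse, mul_apply_eq_comp,
          mul_apply_eq_comp, hu0]
        simp
      have h2 : ‖s (e u)‖ ^ 2 = 0 := by exact_mod_cast h1
      simpa using h2
    have heuN : e u ∈ N := (hN _).mpr ⟨hss, by rw [← mul_apply_eq_comp, he.isIdempotentElem.eq]⟩
    rw [← hee, ← ContinuousLinearMap.adjoint_inner_left, ← ContinuousLinearMap.star_eq_adjoint,
      he.isSelfAdjoint.star_eq]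
    exact hort v _ heuN
  have hpyth : ∀ k v, ‖(y ^ k) (e v)‖ ^ 2 = ‖n v‖ ^ 2 + ‖(y ^ k) (e v - n v)‖ ^ 2 := by
    intro k v
    have h1 : (y ^ k) (e v) = (y ^ k) (n v) + (y ^ k) (e v - n v) := by
      rw [← map_add, add_sub_cancel]
    have h2 : ⟪(y ^ k) (n v), (y ^ k) (e v - n v)⟫_ℂ = 0 := by
      rw [← ContinuousLinearMap.adjoint_inner_left, ← ContinuousLinearMap.star_eq_adjoint,
        (hy.pow k).star_eq, ← mul_apply_eq_comp, (hyN _ (hnN v) k).2]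
      exact hort v _ (hnN v)
    rw [h1, @norm_add_sq ℂ, h2, (hyN _ (hnN v) k).1]
    simp
  have hle : ∀ k v, ‖(y ^ (k + 1)) (e v - n v)‖ ^ 2 ≤ ‖y v‖ ^ 2 := by
    intro k v
    have h1 : ‖(y ^ (k + 1)) (e v - n v)‖ ^ 2 ≤ ‖(y ^ (k + 1)) (e v)‖ ^ 2 := by
      rw [hpyth]
      linarith [sq_nonneg ‖n v‖]
    refine h1.trans ?_
    gcongr
    rw [pow_succ, mul_apply_eq_comp]
    refine (norm_pow_apply_le hy hs hys k _).trans ?_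
    rw [← mul_apply_eq_comp, hye.eq, mul_apply_eq_comp]
    exact ContinuousLinearMap.le_of_opNorm_le _ he.norm_le _ |>.trans (one_mul _).le
  -- One factor of `y` is needed for domination by the summable `‖y (b i)‖²`; the term `k = 0` need
  -- not be summable.
  rw [← tendsto_add_atTop_iff_nat 1]
  have hn := hasSum_norm_starProjection_sq b N
  have hlim : Tendsto (fun k => ∑' i, ‖(y ^ (k + 1)) (e (b i) - n (b i))‖ ^ 2) atTop
      (𝓝 (∑' _ : ι, (0 : ℝ))) := by
    refine tendsto_tsum_of_dominated_convergence hsum (fun i => ?_)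
      (Eventually.of_forall fun k i => ?_)
    · have h1 := tendsto_pow_apply_of_mem_orthogonal_ker hy hs hys hc (hker (b i))
      have h2 := ((h1.comp (tendsto_add_atTop_nat 1)).norm).pow 2
      simpa using h2
    · rw [Real.norm_of_nonneg (sq_nonneg _)]
      exact hle k (b i)
  rw [tsum_zero] at hlim
  have h3 := hlim.const_add (Module.finrank ℂ N : ℝ)
  rw [add_zero] at h3
  refine h3.congr fun k => ?_
  rw [← hn.tsum_eq, ← hn.summable.tsum_add]
  · exact tsum_congr fun i => (hpyth (k + 1) (b i)).symm
  · exact Summable.of_nonneg_of_le (fun i => sq_nonneg _) (fun i => hle k (b i)) hsum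

end Powers

end ProjPair

/-! ### Part (b): algebra of `p - q`, the index, and the trace. -/

namespace ProjPair

open scoped InnerProductSpace
open Filter Topology

variable {H : Type*} [NormedAddCommGroup H] [InnerProductSpace ℂ H]

theorem hasFiniteRange_of_subtype_comp {V W : Type*} [AddCommGroup V] [Module ℂ V]
    [AddCommGroup W] [Module ℂ W] {U : Submodule ℂ W} {D : V →ₗ[ℂ] U}
    (h : (U.subtype ∘ₗ D).HasFiniteRange) : D.HasFiniteRange := by
  rw [LinearMap.HasFiniteRange, LinearMap.range_comp] at h
  exact Submodule.fg_of_fg_map_injective U.subtype U.subtype_injective h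

theorem mem_inf_one_sub_range_iff {p q : H →L[ℂ] H} (hp : IsIdempotentElem p)
    (hq : IsIdempotentElem q) {v : H} :
    v ∈ p.range ⊓ (1 - q).range ↔ p v = v ∧ q v = 0 := by
  rw [Submodule.mem_inf, mem_range_iff_of_isIdempotentElem hp,
    mem_range_iff_of_isIdempotentElem hq.one_sub]
  simp

theorem IsTailSmall.neg {T : H →L[ℂ] H} (h : IsTailSmall T) : IsTailSmall (-T) :=
  h.of_norm_le fun v => by rw [neg_apply, norm_neg]

theorem IsTailSmall.finiteDimensional_inf {p q : H →L[ℂ] H} (hp : IsIdempotentElem p)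
    (hq : IsIdempotentElem q) (h : IsTailSmall (p - q)) :
    FiniteDimensional ℂ (p.range ⊓ (1 - q).range : Submodule ℂ H) := by
  refine h.finiteDimensional fun v hv => ?_
  obtain ⟨h1, h2⟩ := (mem_inf_one_sub_range_iff hp hq).mp hv
  rw [sub_apply, h1, h2, sub_zero]

theorem sub_mul_sub_commute_right {p q : H →L[ℂ] H} (hp : IsIdempotentElem p)
    (hq : IsIdempotentElem q) :
    Commute ((p - q) * (p - q)) q := by
  have hq' : ∀ a, q * (q * a) = q * a := fun a => by rw [← mul_assoc, hq.eq]
  change _ * _ = _ * _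
  simp only [mul_sub, sub_mul, mul_assoc, hp.eq, hq.eq, hq']
  abel

theorem sub_mul_sub_commute_left {p q : H →L[ℂ] H} (hp : IsIdempotentElem p)
    (hq : IsIdempotentElem q) :
    Commute ((p - q) * (p - q)) p := by
  have h := sub_mul_sub_commute_right hq hp
  rwa [← neg_sub p q, neg_mul_neg] at h

/-- This turns the trace into a difference of squared Hilbert–Schmidt norms. -/
theorem diagonal_eq {p q : H →L[ℂ] H} (hp : IsIdempotentElem p) (hq : IsIdempotentElem q) :
    q * (p - q) * q + (1 - q) * (p - q) * (1 - q)
      = (1 - q) * (p - q) * ((p - q) * (1 - q)) - q * (p - q) * ((p - q) * q) := by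
  have hp' : ∀ a, p * (p * a) = p * a := fun a => by rw [← mul_assoc, hp.eq]
  simp only [mul_sub, sub_mul, mul_one, one_mul, mul_assoc, hp.eq, hq.eq, hp']
  abel

variable [CompleteSpace H]

section Fredholm

/-- The quasi-inverse `W`, restricted to `qH → pH`, inverts `q|_{pH}` modulo finite rank on both
sides. -/
theorem isFredholmPair_of_isTailSmall {p q : H →L[ℂ] H} (hp : IsIdempotentElem p)
    (hq : IsIdempotentElem q) (hk : IsTailSmall (q * (1 - p)))
    (hN : FiniteDimensional ℂ (p.range ⊓ (1 - q).range : Submodule ℂ H)) :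
    IsFredholmPair p q := by
  obtain ⟨W, h1, h2, h3⟩ := exists_quasiInverse hp hq hk hN
  let V : q.range →L[ℂ] p.range :=
    (W.comp q.range.subtypeL).codRestrict p.range fun v => ⟨W v, congr($h1 (v : H))⟩
  refine ContinuousLinearMap.IsFredholm.of_isQuasiInverse (v := V) ⟨?_, ?_⟩
  · refine LinearMap.FiniteRangeSetoid.equiv_iff_hasFiniteRange.mpr
      (hasFiniteRange_of_subtype_comp ?_)
    have e : p.range.subtype ∘ₗ (V.toLinearMap ∘ₗ (restrictRange p q).toLinearMap - LinearMap.id)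
        = (W * q * p - p).toLinearMap ∘ₗ p.range.subtype := by
      ext u
      have hu : p u = u := (mem_range_iff_of_isIdempotentElem hp).mp u.2
      change W (q u) - (u : H) = W (q (p u)) - p u
      rw [hu]
    rw [e]
    exact (isFiniteRank_iff.mp h3).comp_right p.range.subtype
  · refine LinearMap.FiniteRangeSetoid.equiv_iff_hasFiniteRange.mpr
      (hasFiniteRange_of_subtype_comp ?_)
    have e : q.range.subtype ∘ₗ ((restrictRange p q).toLinearMap ∘ₗ V.toLinearMap - LinearMap.id)
        = (q * W - q).toLinearMap ∘ₗ q.range.subtype := by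
      ext u
      have hu : q u = u := (mem_range_iff_of_isIdempotentElem hq).mp u.2
      change q (W u) - (u : H) = q (W u) - q u
      rw [hu]
    rw [e]
    exact (isFiniteRank_iff.mp h2).comp_right q.range.subtype

/-- The essential codimension in terms of the meets `p ∧ (1 - q)` and `q ∧ (1 - p)`. -/
theorem essCodim_eq {p q : H →L[ℂ] H} (hp : IsStarProjection p) (hq : IsStarProjection q)
    (h : IsFredholmPair p q) :
    essCodim p q = (Module.finrank ℂ (p.range ⊓ (1 - q).range : Submodule ℂ H) : ℤ)
      - Module.finrank ℂ (q.range ⊓ (1 - p).range : Submodule ℂ H) := by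
  have hpi := hp.isIdempotentElem
  have hqi := hq.isIdempotentElem
  let T := restrictRange p q
  have hT : ∀ u : p.range, ((T u : q.range) : H) = q u := fun u => rfl
  have hker : T.ker.map p.range.subtype = p.range ⊓ (1 - q).range := by
    ext v
    rw [mem_inf_one_sub_range_iff hpi hqi]
    constructor
    · rintro ⟨u, hu, rfl⟩
      have hu' : T u = 0 := hu
      refine ⟨(mem_range_iff_of_isIdempotentElem hpi).mp u.2, ?_⟩
      have := congrArg Subtype.val hu'
      exact this
    · rintro ⟨h1, h2⟩
      exact ⟨⟨v, (mem_range_iff_of_isIdempotentElem hpi).mpr h1⟩, Subtype.ext h2, rfl⟩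
  have : CompleteSpace q.range :=
    (ContinuousLinearMap.IsIdempotentElem.isClosed_range hqi).completeSpace_coe
  have : CompleteSpace T.range := h.isClosed_range.completeSpace_coe
  have hcoker : (T.range)ᗮ.map q.range.subtype = q.range ⊓ (1 - p).range := by
    ext v
    rw [mem_inf_one_sub_range_iff hqi hpi]
    constructor
    · rintro ⟨u, hu, rfl⟩
      have hqu : q (u : H) = u := (mem_range_iff_of_isIdempotentElem hqi).mp u.2
      refine ⟨hqu, ?_⟩
      have h1 : ∀ w, ⟪q (p w), (u : H)⟫_ℂ = 0 := fun w => hu (T ⟨p w, w, rfl⟩) ⟨_, rfl⟩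
      -- Testing with `w = u` gives `⟨q p u, u⟩ = ‖p u‖² = 0`.
      have h2 := h1 (u : H)
      rw [← ContinuousLinearMap.adjoint_inner_right, ← ContinuousLinearMap.star_eq_adjoint,
        hq.isSelfAdjoint.star_eq, hqu, ← congr($(hpi.eq) (u : H)), mul_apply_eq_comp,
        ← ContinuousLinearMap.adjoint_inner_right, ← ContinuousLinearMap.star_eq_adjoint,
        hp.isSelfAdjoint.star_eq] at h2
      exact inner_self_eq_zero.mp h2
    · rintro ⟨h1, h2⟩
      refine ⟨⟨v, (mem_range_iff_of_isIdempotentElem hqi).mpr h1⟩, ?_, rfl⟩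
      rintro _ ⟨u, rfl⟩
      change ⟪q u, v⟫_ℂ = 0
      have hu : p u = u := (mem_range_iff_of_isIdempotentElem hpi).mp u.2
      rw [← ContinuousLinearMap.adjoint_inner_right, ← ContinuousLinearMap.star_eq_adjoint,
        hq.isSelfAdjoint.star_eq, h1, ← hu, ← ContinuousLinearMap.adjoint_inner_right,
        ← ContinuousLinearMap.star_eq_adjoint, hp.isSelfAdjoint.star_eq, h2, inner_zero_right]
  have e := Submodule.quotientEquivOfIsCompl T.range T.rangeᗮ
    T.range.isCompl_orthogonal
  rw [essCodim, fredholmIndex, ← hker, ← hcoker, Submodule.finrank_map_subtype_eq,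
    Submodule.finrank_map_subtype_eq, ← e.finrank_eq]

end Fredholm

section Trace

variable {p q : H →L[ℂ] H}

theorem sub_sq_add_one_sub_sub_sq (hp : IsStarProjection p) (hq : IsStarProjection q) :
    (p - q) * (p - q) + (1 - p - q) * (1 - p - q) = 1 := by
  simp only [mul_sub, sub_mul, mul_one, one_mul, hp.isIdempotentElem.eq, hq.isIdempotentElem.eq]
  abel

/-- `|p - q|` is a function of `(p - q)²`. -/
theorem commute_abs_sub (hp : IsStarProjection p) (hq : IsStarProjection q) {a : H →L[ℂ] H}
    (h : Commute ((p - q) * (p - q)) a) : Commute (CFC.abs (p - q)) a := by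
  have hx : star (p - q) = p - q := (hp.isSelfAdjoint.sub hq.isSelfAdjoint).star_eq
  rw [CFC.abs, hx, CFC.sqrt]
  exact h.cfcₙ_nnreal _

/-- The off-diagonal operator `(1 - p - q) |p - q|ᵏ⁺¹` has corners of equal Hilbert–Schmidt norm. -/
theorem hasSum_norm_offDiag_sq {ι : Type*} (b : HilbertBasis ι ℂ H)
    (hp : IsStarProjection p) (hq : IsStarProjection q) (k : ℕ) {a : ℝ}
    (h : HasSum (fun i =>
      ‖(1 - p - q) (((CFC.abs (p - q)) ^ (k + 1)) ((1 - q) (b i)))‖ ^ 2) a) :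
    HasSum (fun i => ‖(1 - p - q) (((CFC.abs (p - q)) ^ (k + 1)) (q (b i)))‖ ^ 2) a := by
  have hpi := hp.isIdempotentElem
  have hqi := hq.isIdempotentElem
  set x := p - q with hx
  set s := 1 - p - q with hs
  set y := CFC.abs x with hy
  have hyp : Commute y p := commute_abs_sub hp hq (sub_mul_sub_commute_left hpi hqi)
  have hyq : Commute y q := commute_abs_sub hp hq (sub_mul_sub_commute_right hpi hqi)
  have hys : Commute y s := ((Commute.one_right y).sub_right hyp).sub_right hyq
  have hyx : Commute y x := hyp.sub_right hyq
  have hysa : IsSelfAdjoint y := IsSelfAdjoint.of_nonneg (CFC.abs_nonneg x)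
  have hxsa : IsSelfAdjoint x := hp.isSelfAdjoint.sub hq.isSelfAdjoint
  have hssa : IsSelfAdjoint s :=
    ((IsSelfAdjoint.one _).sub hp.isSelfAdjoint).sub hq.isSelfAdjoint
  have hxs : x * s = -(s * x) := by
    simp only [hx, hs, mul_sub, sub_mul, mul_one, one_mul, hpi.eq, hqi.eq]
    abel
  -- `s x` is the commutator `p q - q p`, which is skew-adjoint and off-diagonal with respect to
  -- `q`; hence the corners of `s x y^k` are adjoint up to sign.
  have hsxq : s * x * (1 - q) = q * (s * x) := by
    have hq' : ∀ a, q * (q * a) = q * a := fun a => by rw [← mul_assoc, hqi.eq]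
    simp only [hx, hs, mul_sub, sub_mul, mul_one, one_mul, mul_assoc, hpi.eq, hqi.eq, hq']
    abel
  have hnorm : ∀ v, ‖s ((y ^ (k + 1)) v)‖ = ‖(s * x * y ^ k) v‖ := by
    intro v
    have h1 : s ((y ^ (k + 1)) v) = y (s ((y ^ k) v)) := by
      rw [pow_succ' y, mul_apply_eq_comp]
      exact congr($(hys.eq.symm) ((y ^ k) v))
    rw [h1, norm_abs_apply, ← mul_apply_eq_comp x s, hxs, neg_apply, norm_neg]
    rfl
  simp only [hnorm] at h ⊢
  have h1 : HasSum (fun i => ‖(s * x * y ^ k * (1 - q)) (b i)‖ ^ 2) a := h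
  have h2 := hasSum_norm_star_sq b h1
  have h3 : star (s * x * y ^ k * (1 - q)) = -(s * x * y ^ k * q) := by
    have hc : Commute (s * x) (y ^ k) := ((hys.symm.mul_left hyx.symm)).pow_right k
    have hcq : Commute (y ^ k) (1 - q) := ((Commute.one_right y).sub_right hyq).pow_left k
    rw [mul_assoc, hcq.eq, ← mul_assoc, hsxq, star_mul, star_mul, star_mul, (hysa.pow k).star_eq,
      hxsa.star_eq, hssa.star_eq, hq.isSelfAdjoint.star_eq, hxs, hc.eq]
    simp only [mul_neg, neg_mul, mul_assoc]
  rw [h3] at h2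
  simpa only [neg_apply, norm_neg, mul_apply_eq_comp] using h2

/-- The dimension count for a pair of projections with Hilbert–Schmidt difference. -/
theorem hasSum_norm_sq_sub_norm_sq {ι : Type*} (b : HilbertBasis ι ℂ H)
    (hp : IsStarProjection p) (hq : IsStarProjection q)
    (hsum : Summable fun i => ‖(p - q) (b i)‖ ^ 2) :
    HasSum (fun i => ‖(p - q) ((1 - q) (b i))‖ ^ 2 - ‖(p - q) (q (b i))‖ ^ 2)
      ((Module.finrank ℂ (p.range ⊓ (1 - q).range : Submodule ℂ H) : ℝ)
        - Module.finrank ℂ (q.range ⊓ (1 - p).range : Submodule ℂ H)) := by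
  have hpi := hp.isIdempotentElem
  have hqi := hq.isIdempotentElem
  have hsmall := isTailSmall_of_summable b hsum
  have hN := hsmall.finiteDimensional_inf hpi hqi
  have hsmall' : IsTailSmall (q - p) := by
    rw [← neg_sub]
    exact hsmall.neg
  have hM := hsmall'.finiteDimensional_inf hqi hpi
  set x := p - q with hx
  set s := 1 - p - q with hs
  set y := CFC.abs x with hy
  have hyp : Commute y p := commute_abs_sub hp hq (sub_mul_sub_commute_left hpi hqi)
  have hyq : Commute y q := commute_abs_sub hp hq (sub_mul_sub_commute_right hpi hqi)
  have hyq' : Commute y (1 - q) := (Commute.one_right y).sub_right hyq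
  have hys : Commute y s := ((Commute.one_right y).sub_right hyp).sub_right hyq
  have hysa : IsSelfAdjoint y := IsSelfAdjoint.of_nonneg (CFC.abs_nonneg x)
  have hxsa : IsSelfAdjoint x := hp.isSelfAdjoint.sub hq.isSelfAdjoint
  have hssa : IsSelfAdjoint s :=
    ((IsSelfAdjoint.one _).sub hp.isSelfAdjoint).sub hq.isSelfAdjoint
  have hyy : y * y + s * s = 1 := by
    rw [hy, CFC.abs_mul_abs, hxsa.star_eq]
    exact sub_sq_add_one_sub_sub_sq hp hq
  have hysum : Summable fun i => ‖y (b i)‖ ^ 2 := hsum.congr fun i => by rw [norm_abs_apply]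
  have hNmem : ∀ v, v ∈ p.range ⊓ (1 - q).range ↔ s v = 0 ∧ (1 - q) v = v := by
    intro v
    rw [mem_inf_one_sub_range_iff hpi hqi]
    simp only [hs, sub_apply, one_apply_eq_self, sub_eq_self]
    constructor
    · rintro ⟨h1, h2⟩
      simp [h1, h2]
    · rintro ⟨h1, h2⟩
      rw [h2, sub_zero, sub_eq_zero] at h1
      exact ⟨h1.symm, h2⟩
  have hMmem : ∀ v, v ∈ q.range ⊓ (1 - p).range ↔ s v = 0 ∧ q v = v := by
    intro v
    rw [mem_inf_one_sub_range_iff hqi hpi]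
    simp only [hs, sub_apply, one_apply_eq_self]
    constructor
    · rintro ⟨h1, h2⟩
      simp [h1, h2]
    · rintro ⟨h1, h2⟩
      rw [h2, sub_right_comm, sub_self, zero_sub, neg_eq_zero] at h1
      exact ⟨h2, h1⟩
  have hlim := (tendsto_tsum_norm_pow_sq b hysa hssa hyy hys hq.one_sub hyq' hysum _ hNmem).sub
    (tendsto_tsum_norm_pow_sq b hysa hssa hyy hys hq hyq hysum _ hMmem)
  have hS : ∀ e : H →L[ℂ] H, IsStarProjection e → Commute y e → ∀ k,
      Summable fun i => ‖(y ^ (k + 1)) (e (b i))‖ ^ 2 := by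
    intro e he hye k
    refine Summable.of_nonneg_of_le (fun i => sq_nonneg _) (fun i => ?_) hysum
    gcongr
    rw [pow_succ, mul_apply_eq_comp]
    refine (norm_pow_apply_le hysa hssa hyy k _).trans ?_
    rw [← mul_apply_eq_comp, hye.eq, mul_apply_eq_comp]
    exact ContinuousLinearMap.le_of_opNorm_le _ he.norm_le _ |>.trans (one_mul _).le
  have hdiff : ∀ (k : ℕ) (v : H),
      ‖s ((y ^ k) v)‖ ^ 2 = ‖(y ^ k) v‖ ^ 2 - ‖(y ^ (k + 1)) v‖ ^ 2 := by
    intro k v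
    have := norm_sq_add_norm_sq hysa hssa hyy ((y ^ k) v)
    rw [pow_succ' y, mul_apply_eq_comp]
    linarith
  -- By `hdiff`, one step changes the two sums by the squared norms of the two corners of `s
  -- y^(k+1)`, which are equal.
  have hconst : ∀ k, (∑' i, ‖(y ^ (k + 1)) ((1 - q) (b i))‖ ^ 2)
      - (∑' i, ‖(y ^ (k + 1)) (q (b i))‖ ^ 2)
      = (∑' i, ‖(y ^ 1) ((1 - q) (b i))‖ ^ 2) - (∑' i, ‖(y ^ 1) (q (b i))‖ ^ 2) := by
    intro k
    induction k with
    | zero => rfl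
    | succ k ih =>
      rw [← ih]
      have h1 := (hS _ hq.one_sub hyq' k).hasSum.sub (hS _ hq.one_sub hyq' (k + 1)).hasSum
      have h2 := (hS _ hq hyq k).hasSum.sub (hS _ hq hyq (k + 1)).hasSum
      simp only [← hdiff] at h1 h2
      have h3 := (hasSum_norm_offDiag_sq b hp hq k h1).unique h2
      linarith
  have hval := tendsto_nhds_unique (hlim.comp (tendsto_add_atTop_nat 1))
    (tendsto_const_nhds.congr fun k => (hconst k).symm)
  rw [hval]
  have h1 := (hS _ hq.one_sub hyq' 0).hasSum.sub (hS _ hq hyq 0).hasSum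
  simpa only [zero_add, pow_one, norm_abs_apply, hy] using h1

/-- The diagonal part is `x² (1 - 2q)`, and `1 - 2q` is a symmetry commuting with `x²`, so its
square is `x⁴`. Trace class then reduces to summability of `‖x (b i)‖²`. -/
theorem abs_diagonal_eq (hp : IsStarProjection p) (hq : IsStarProjection q) :
    CFC.abs (q * (p - q) * q + (1 - q) * (p - q) * (1 - q)) = (p - q) * (p - q) := by
  have hxsa : IsSelfAdjoint (p - q) := hp.isSelfAdjoint.sub hq.isSelfAdjoint
  have hT : star (q * (p - q) * q + (1 - q) * (p - q) * (1 - q))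
      = q * (p - q) * q + (1 - q) * (p - q) * (1 - q) := by
    simp only [star_add, star_mul, hxsa.star_eq, hq.isSelfAdjoint.star_eq,
      hq.one_sub.isSelfAdjoint.star_eq, mul_assoc]
  rw [CFC.abs, hT]
  refine CFC.sqrt_unique ?_ ?_
  · have hp' : ∀ a, p * (p * a) = p * a := fun a => by
      rw [← mul_assoc, hp.isIdempotentElem.eq]
    have hq' : ∀ a, q * (q * a) = q * a := fun a => by
      rw [← mul_assoc, hq.isIdempotentElem.eq]
    simp only [mul_sub, sub_mul, mul_add, add_mul, mul_one, one_mul, mul_assoc,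
      hp.isIdempotentElem.eq, hq.isIdempotentElem.eq, hp', hq']
    abel
  · have := star_mul_self_nonneg (p - q)
    rwa [hxsa.star_eq] at this

theorem isFredholmPair_and_hasTrace (hp : IsStarProjection p) (hq : IsStarProjection q)
    (h : IsHilbertSchmidt (p - q)) :
    IsFredholmPair p q ∧
      HasTrace (q * (p - q) * q + (1 - q) * (p - q) * (1 - q)) (essCodim p q : ℂ) := by
  have hpi := hp.isIdempotentElem
  have hqi := hq.isIdempotentElem
  have hxsa : star (p - q) = p - q := (hp.isSelfAdjoint.sub hq.isSelfAdjoint).star_eq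
  obtain ⟨w, b₀, -⟩ := exists_hilbertBasis ℂ H
  have hsmall := isTailSmall_of_summable b₀ (h w b₀)
  have hk : IsTailSmall (q * (1 - p)) := by
    refine hsmall.of_norm_le fun v => ?_
    have : q * (1 - p) = -(q * (p - q)) := by
      simp only [mul_sub, mul_one, hqi.eq, neg_sub]
    rw [this, neg_apply, norm_neg, mul_apply_eq_comp]
    exact ContinuousLinearMap.le_of_opNorm_le _ hq.norm_le _ |>.trans (one_mul _).le
  have hF := isFredholmPair_of_isTailSmall hpi hqi hk (hsmall.finiteDimensional_inf hpi hqi)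
  refine ⟨hF, fun s b => ?_, fun s b => ?_⟩
  · rw [abs_diagonal_eq hp hq]
    refine (Complex.hasSum_ofReal.mpr (h s b).hasSum).summable.congr fun i => ?_
    rw [norm_sq_apply_eq, hxsa]
  · have h1 := Complex.hasSum_ofReal.mpr (hasSum_norm_sq_sub_norm_sq b hp hq (h s b))
    rw [essCodim_eq hp hq hF]
    convert h1 using 1
    · ext i
      have h2 : ∀ e : H →L[ℂ] H, IsStarProjection e →
          star ((p - q) * e) * ((p - q) * e) = e * (p - q) * ((p - q) * e) := fun e he => by
        rw [star_mul, hxsa, he.isSelfAdjoint.star_eq]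
      rw [diagonal_eq hpi hqi, ← h2 _ hq, ← h2 _ hq.one_sub, sub_apply, inner_sub_right,
        ← norm_sq_apply_eq, ← norm_sq_apply_eq, Complex.ofReal_sub]
      rfl
    · push_cast
      rfl

end Trace

end ProjPair

theorem mainTheorem3 {H : Type*} [NormedAddCommGroup H] [InnerProductSpace ℂ H] [CompleteSpace H]
    [TopologicalSpace.SeparableSpace H] (hH : ¬ FiniteDimensional ℂ H)
    (p q : H →L[ℂ] H) (hp : IsStarProjection p) (hq : IsStarProjection q) :
    (∀ J : Ideal (H →L[ℂ] H), J.IsTwoSided → J ≠ ⊥ → J ≠ ⊤ →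
      List.TFAE [
        p - q ∈ J,
        q * (p - q) * q ∈ J ^ 2 ∧ (1 - q) * (p - q) * (1 - q) ∈ J ^ 2,
        (ProjPair.IsFiniteRank (ProjPair.projMeet p (1 - q)) ∧
            ProjPair.IsFiniteRank (ProjPair.projMeet (1 - p) q)) ∧
          (q * (p - q) * q ∈ J ^ 2 ∨ (1 - q) * (p - q) * (1 - q) ∈ J ^ 2)]) ∧
    (ProjPair.IsHilbertSchmidt (p - q) →
      ProjPair.IsFredholmPair p q ∧
        ProjPair.HasTrace (q * (p - q) * q + (1 - q) * (p - q) * (1 - q))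
          (ProjPair.essCodim p q : ℂ)) :=
  ⟨fun _ hJ hJ0 hJ1 => have := hJ; ProjPair.tfae_sub_mem hJ0 hJ1 hp hq,
    ProjPair.isFredholmPair_and_hasTrace hp hq⟩
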